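/- Let $n,k,h,d$ be integers with $k\ge 1$ and $2\le h\le n-d\le n-k$, and put $s=d+1-k$. Let $F$ be a finite field with $|F|\ge sn$. Then there exist $sn$ distinct elements $\lambda_{i,j}\in F$ ($1\le i\le n$, $0\le j\le s-1$). For any such choice, let $\mathcal C$ be the linear array code of length $n$ and node size $l=(d+h-k)s^n$ consisting of all $(C_1,\dots,C_n)$, $C_i=(c_{i,b,a}: 1\le b\le d+h-k,\ 0\le a\le s^n-1)\in F^l$, such that $$\sum_{i=1}^n \lambda_{i,a_i}^t\, c_{i,b,a}=0\qquad\text{for all } 0\le t\le n-k-1,\ 1\le b\le d+h-k,\ 0\le a\le s^n-1,$$ where $(a_1,\dots,a_n)$ are the $n$ digits of $a$ in base $s$. A cooperative repair scheme for disjoint sets $\mathcal F$ (failed nodes) and $\mathcal R$ (helper nodes) works in finitely many rounds; in each round every helper sends to each failed node a prescribed number of symbols of $F$ that are functions of the helper's content, and every failed node sends to each other failed node a prescribed number of symbols that are functions of what it has received in earlier rounds; at the end every failed node $C_j$, $j\in\mathcal F$, must be able to compute its content from what it has received, for every codeword. Let $N_{\mathrm{co}}(\mathcal C,\mathcal F,\mathcal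 R)$ be the smallest total number of symbols of $F$ transmitted between different nodes by such a scheme. Then $\mathcal C$ is an $(h,d)$-MSR code under the cooperative model, that is: (1) $\mathcal C$ is an $(n,k,l)$ MDS array code: the contents of any $k$ nodes can be arbitrary and determine the codeword; (2) for all disjoint $\mathcal F,\mathcal R\subseteq\{1,\dots,n\}$ with $|\mathcal F|=h$ and $|\mathcal R|=d$, the cut-set bound is attained, $$N_{\mathrm{co}}(\mathcal C,\mathcal F,\mathcal R)=\frac{h(d+h-1)\,l}{h+d-k}=h(d+h-1)s^n,$$ and this value is achieved by a scheme with two rounds. -/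

import Mathlib

/-- `C` is an `(n, k, l)` MDS array code over `F`, where a node is a vector in `F ^ l` whose
coordinates are indexed by `ι` (so `l = |ι|`): for every set `S` of `k` nodes, the contents of the
nodes in `S` can be prescribed arbitrarily (the nodes in `S` can serve as information nodes) and
they determine the whole codeword. -/
def IsMDSArrayCode {F ι : Type*} [Field F] {n : ℕ} (k : ℕ)
    (C : Submodule F (Fin n → ι → F)) : Prop :=
  ∀ S : Finset (Fin n), S.card = k →
    Function.Bijective (fun (c : C) (i : S) => (c : Fin n → ι → F) i)

/-- A repair scheme in the cooperative model for the set `Fs` of failed nodes and the set `R` of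
helper nodes. Communication takes place in `rounds` rounds. In round `t`, every participant `i`
(a helper `Sum.inl i` or a failed node `Sum.inr i`) sends `len t i j` symbols of `F` to every
failed node `j`. What a helper sends is a function of its own content; what a failed node sends is
a function of all symbols it has received in the previous rounds. After the last round each failed
node computes its content from all symbols it has received. -/
structure CooperativeScheme (F ι : Type*) {n : ℕ} (Fs R : Finset (Fin n)) where
  rounds : ℕ
  len : Fin rounds → R ⊕ Fs → Fs → ℕ
  helperMsg : ∀ (t : Fin rounds) (i : R) (j : Fs), (ι → F) → Fin (len t (Sum.inl i) j) → F
  failedMsg : ∀ (t : Fin rounds) (i j : Fs),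
    (∀ t' : Fin rounds, t' < t → ∀ i' : R ⊕ Fs, Fin (len t' i' i) → F) →
      Fin (len t (Sum.inr i) j) → F
  decode : ∀ j : Fs, (∀ (t : Fin rounds) (i : R ⊕ Fs), Fin (len t i j) → F) → ι → F

namespace CooperativeScheme

variable {F ι : Type*} {n : ℕ} {Fs R : Finset (Fin n)}

/-- The symbols that are sent by `i` to `j` in round `t` when the stored codeword is `c`; only the
contents `c i` of helpers `i ∈ R` are used. -/
def msg (S : CooperativeScheme F ι Fs R) (c : Fin n → ι → F) (t : Fin S.rounds) :
    ∀ (i : R ⊕ Fs) (j : Fs), Fin (S.len t i j) → F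
  | Sum.inl i, j => S.helperMsg t i j (c i)
  | Sum.inr i, j => S.failedMsg t i j (fun t' _ i' => S.msg c t' i' i)
termination_by t

/-- The scheme repairs the failed nodes of every codeword of `C`. -/
def Repairs [Field F] (S : CooperativeScheme F ι Fs R) (C : Submodule F (Fin n → ι → F)) : Prop :=
  ∀ c ∈ C, ∀ j : Fs, S.decode j (fun t i => S.msg c t i j) = c j

/-- The total number of symbols of `F` exchanged between different nodes. -/
def bandwidth (S : CooperativeScheme F ι Fs R) : ℕ :=
  ∑ t, ∑ i, ∑ j, if i = Sum.inr j then 0 else S.len t i j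

end CooperativeScheme

/-- `N_co(C, Fs, R)`: the smallest number of symbols of `F` that have to be downloaded to recover
the nodes in `Fs` from the nodes in `R` in the cooperative model (`⊤` if this is impossible). -/
noncomputable def cooperativeBandwidth {F ι : Type*} [Field F] {n : ℕ}
    (C : Submodule F (Fin n → ι → F)) (Fs R : Finset (Fin n)) : ℕ∞ :=
  ⨅ (S : CooperativeScheme F ι Fs R) (_ : S.Repairs C), (S.bandwidth : ℕ∞)

/-- `C` is an `(h, d)`-MSR code in the cooperative model: it is MDS, and the cut-set bound holds
with equality for any `h` failed nodes and any `d` helper nodes. -/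
def IsCooperativeMSR {F ι : Type*} [Field F] [Fintype ι] {n : ℕ} (k h d : ℕ)
    (C : Submodule F (Fin n → ι → F)) : Prop :=
  IsMDSArrayCode k C ∧
    ∀ Fs R : Finset (Fin n), Disjoint Fs R → Fs.card = h → R.card = d →
      ∃ N : ℕ, cooperativeBandwidth C Fs R = N ∧
        (N : ℚ) = (h : ℚ) * ((d : ℚ) + h - 1) * (Fintype.card ι : ℚ) / ((h : ℚ) + d - k)

/-- The array code given by the parity checks `∑ i, lam i (a i) ^ t * c i (b, a) = 0` for all
`t < n - k`, `b` in a set of `m` elements and `a ∈ {0, …, s ^ n - 1}`, where `a` is represented by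
its `n` digits in base `s`. -/
def replicatedCode {F : Type*} [Field F] (n k m s : ℕ) (lam : Fin n → Fin s → F) :
    Submodule F (Fin n → Fin m × (Fin n → Fin s) → F) where
  carrier := {c | ∀ t < n - k, ∀ (b : Fin m) (a : Fin n → Fin s),
    ∑ i, lam i (a i) ^ t * c i (b, a) = 0}
  zero_mem' := by
    intro t _ b a
    simp
  add_mem' := by
    intro x y hx hy t ht b a
    have h1 := hx t ht b a
    have h2 := hy t ht b a
    simp only [Pi.add_apply, mul_add, Finset.sum_add_distrib, h1, h2, add_zero]
  smul_mem' := by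
    intro r x hx t ht b a
    have h1 := hx t ht b a
    simp only [Pi.smul_apply, smul_eq_mul, mul_left_comm _ r, ← Finset.mul_sum, h1, mul_zero]

/-! Everything rests on Vandermonde systems at the distinct points `lam i u`. For fixed `(b, a)` the
checks on any `n - k` nodes form such a system, so the code is MDS.

Lower bound (`cut_set_le_bandwidth`): fix `T` failed and `A` helper nodes, `k` in total. By MDS the
contents of `T` are free while those of `A` are zero, so all information about `T` comes from
outside `A ∪ T`. Averaging over relabelings leaves, for each `u = |T|`, one inequality between
helper traffic and failed-node traffic; `u = 1` and `u = min k h` combine to the bound.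

Upper bound (`eq_zero_of_lineSum_eq_zero`): adding the checks along a line in direction `i`, with a
different replica at each point, leaves `s` unknowns from node `i` and one line sum from every other
node. Since `d` line sums are downloaded, `s + n - 1 - d = n - k` unknowns remain, and node `i`
finds them all. It thus also learns the line sums of the other failed nodes, to be forwarded in
round two. Such a sum has a single term in the replica private to `i`; its receiver already knows
the others. -/

/-! ### Vandermonde systems and the MDS property -/

/-- A family of weights whose weighted power sums at distinct points vanish, for as many exponents
as there are points, is zero. -/
theorem eq_zero_of_forall_sum_pow_mul_eq_zero {F ι : Type*} [Field F] [Fintype ι] {x y : ι → F}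
    (hx : Function.Injective x) (m : ℕ) (hm : Fintype.card ι ≤ m)
    (h : ∀ t < m, ∑ i, x i ^ t * y i = 0) : y = 0 := by
  classical
  let e := Fintype.equivFin ι
  have key : (y ∘ e.symm) = 0 := by
    apply Matrix.eq_zero_of_forall_pow_sum_mul_pow_eq_zero (f := x ∘ e.symm)
      (hx.comp e.symm.injective)
    intro t
    rw [← h t (t.2.trans_le hm), ← Equiv.sum_comp e.symm]
    exact Finset.sum_congr rfl fun i _ => mul_comm _ _
  funext i
  simpa using congrFun key (e i)

/-- Weighted power sums at distinct points, for as many exponents as there are points, can be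
prescribed arbitrarily. -/
theorem exists_forall_sum_pow_mul_eq {F ι : Type*} [Field F] [Fintype ι] {x : ι → F}
    (hx : Function.Injective x) (v : ℕ → F) :
    ∃ y : ι → F, ∀ t < Fintype.card ι, ∑ i, x i ^ t * y i = v t := by
  classical
  let f : (ι → F) →ₗ[F] (Fin (Fintype.card ι) → F) :=
    { toFun := fun y t => ∑ i, x i ^ (t : ℕ) * y i
      map_add' := fun y z => by
        funext t
        simp [mul_add, Finset.sum_add_distrib]
      map_smul' := fun r y => by
        funext t
        simp [Finset.mul_sum, mul_left_comm] }
  have hinj : Function.Injective f := by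
    rw [← LinearMap.ker_eq_bot, LinearMap.ker_eq_bot']
    intro y hy
    exact eq_zero_of_forall_sum_pow_mul_eq_zero hx _ le_rfl fun t ht => congrFun hy ⟨t, ht⟩
  obtain ⟨y, hy⟩ := (LinearMap.injective_iff_surjective_of_finrank_eq_finrank (by simp)).1 hinj
    (fun t => v t)
  exact ⟨y, fun t ht => congrFun hy ⟨t, ht⟩⟩

theorem mem_replicatedCode {F : Type*} [Field F] {n k m s : ℕ} {lam : Fin n → Fin s → F}
    {c : Fin n → Fin m × (Fin n → Fin s) → F} :
    c ∈ replicatedCode n k m s lam ↔ ∀ t < n - k, ∀ (b : Fin m) (a : Fin n → Fin s),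
      ∑ i, lam i (a i) ^ t * c i (b, a) = 0 :=
  Iff.rfl

/-- The checks for different `(b, a)` decouple; each leaves `n - k` equations in the `n - k` nodes
outside `S`, at distinct points. -/
theorem isMDSArrayCode_replicatedCode {F : Type*} [Field F] {n k m s : ℕ}
    {lam : Fin n → Fin s → F} (hlam : Function.Injective (Function.uncurry lam)) :
    IsMDSArrayCode k (replicatedCode n k m s lam) := by
  classical
  intro S hS
  have hcard : Fintype.card {i // i ∉ S} = n - k := by
    rw [Fintype.card_subtype_compl, Fintype.card_fin, Fintype.card_coe, hS]
  have hinj : ∀ a : Fin n → Fin s,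
      Function.Injective (fun i : {i // i ∉ S} => lam i (a i)) := by
    intro a i j hij
    have := @hlam (i.1, a i) (j.1, a j) hij
    exact Subtype.ext (Prod.ext_iff.1 this).1
  have hsplit : ∀ f : Fin n → F, ∑ i, f i = ∑ i : S, f i + ∑ i : {i // i ∉ S}, f i := by
    intro f
    rw [← Fintype.sum_subtype_add_sum_subtype (· ∈ S) f]
    congr!
  constructor
  · rintro ⟨c, hc⟩ ⟨c', hc'⟩ h
    have hmem := (replicatedCode n k m s lam).sub_mem hc hc'
    have hzero : ∀ i ∈ S, (c - c') i = 0 := fun i hi => sub_eq_zero.2 (congrFun h ⟨i, hi⟩)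
    refine Subtype.ext (sub_eq_zero.1 ?_)
    funext i ⟨b, a⟩
    by_cases hi : i ∈ S
    · rw [hzero i hi]; rfl
    · have := eq_zero_of_forall_sum_pow_mul_eq_zero (hinj a) (n - k) hcard.le
        (y := fun i : {i // i ∉ S} => (c - c') i (b, a)) (by
          intro t ht
          have h0 := mem_replicatedCode.1 hmem t ht b a
          rw [hsplit, Finset.sum_eq_zero, zero_add] at h0
          · exact h0
          · intro i _
            rw [hzero i i.2]; simp)
      exact congrFun this ⟨i, hi⟩
  · intro v
    choose y hy using fun ba : Fin m × (Fin n → Fin s) =>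
      exists_forall_sum_pow_mul_eq (hinj ba.2) (fun t => -∑ i : S, lam i (ba.2 i) ^ t * v i ba)
    refine ⟨⟨fun i ba => if hi : i ∈ S then v ⟨i, hi⟩ ba else y ba ⟨i, hi⟩, ?_⟩, ?_⟩
    · rw [mem_replicatedCode]
      intro t ht b a
      rw [hsplit]
      have h1 := hy (b, a) t (hcard ▸ ht)
      rw [eq_neg_iff_add_eq_zero, add_comm] at h1
      rw [← h1]
      congr 1
      · exact Finset.sum_congr rfl fun i _ => by rw [dif_pos i.2]
      · exact Finset.sum_congr rfl fun i _ => by rw [dif_neg i.2]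
    · funext i ba
      simp

/-! ### Cut-set lower bound -/

/-- In a scheme that repairs an MDS array code, consider `T` failed and `A` helper nodes, `k` in
total. What the nodes in `T` receive from nodes outside of `A` and `T` has at least the size of
the contents of the nodes in `T`. -/
theorem CooperativeScheme.card_mul_card_le_sum_len {F ι : Type*} [Field F] [Fintype F]
    [Fintype ι] {n k : ℕ} {C : Submodule F (Fin n → ι → F)} (hC : IsMDSArrayCode k C)
    {Fs R : Finset (Fin n)} (hFR : Disjoint Fs R) (S : CooperativeScheme F ι Fs R)
    (hS : S.Repairs C) (T : Finset Fs) (A : Finset R) (hTA : T.card + A.card = k) :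
    T.card * Fintype.card ι ≤ ∑ j ∈ T, (∑ i ∈ Aᶜ, ∑ t, S.len t (Sum.inl i) j +
      ∑ i ∈ Tᶜ, ∑ t, S.len t (Sum.inr i) j) := by
  classical
  let U : Finset (Fin n) := T.map (Function.Embedding.subtype _) ∪
    A.map (Function.Embedding.subtype _)
  have hdisj : Disjoint (T.map (Function.Embedding.subtype _))
      (A.map (Function.Embedding.subtype _)) := by
    rw [Finset.disjoint_left]
    intro x hx hx'
    simp only [Finset.mem_map, Function.Embedding.subtype_apply] at hx hx'
    obtain ⟨y, -, rfl⟩ := hx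
    obtain ⟨z, -, hz⟩ := hx'
    exact Finset.disjoint_left.1 hFR y.2 (hz ▸ z.2)
  have hU : U.card = k := by
    rw [Finset.card_union_of_disjoint hdisj, Finset.card_map, Finset.card_map, hTA]
  have hex : ∀ v : T → ι → F, ∃ c ∈ C, (∀ j : T, c j = v j) ∧ ∀ i ∈ A, c i = 0 := by
    intro v
    obtain ⟨c, hc⟩ := (hC U hU).2 (fun i => if hi : ∃ j : T, (j : Fin n) = i then
      v hi.choose else 0)
    refine ⟨c, c.2, ?_, ?_⟩
    · intro j
      have hj : (j : Fin n) ∈ U := Finset.mem_union_left _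
        (Finset.mem_map_of_mem (Function.Embedding.subtype _) j.2)
      have h1 := congrFun hc ⟨j, hj⟩
      have h2 : ∃ j' : T, (j' : Fin n) = j := ⟨j, rfl⟩
      simp only [dif_pos h2] at h1
      rw [h1]
      exact congrArg v (Subtype.ext (Subtype.ext h2.choose_spec))
    · intro i hi
      have hi' : (i : Fin n) ∈ U := Finset.mem_union_right _
        (Finset.mem_map_of_mem (Function.Embedding.subtype _) hi)
      have h1 := congrFun hc ⟨i, hi'⟩
      have h2 : ¬ ∃ j' : T, (j' : Fin n) = i := by
        rintro ⟨j, hj⟩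
        exact Finset.disjoint_left.1 hFR j.1.2 (hj ▸ i.2)
      simpa only [dif_neg h2] using h1
  choose c hcC hcT hcA using hex
  let O : Finset (R ⊕ Fs) := Aᶜ.disjSum Tᶜ
  let Φ : (T → ι → F) → ∀ (j : T) (i : O) (t : Fin S.rounds), Fin (S.len t i j) → F :=
    fun v j i t => S.msg (c v) t i j
  have hΦ : Function.Injective Φ := by
    intro v w hvw
    have hmsg : ∀ (m : ℕ) (t : Fin S.rounds), (t : ℕ) = m → ∀ (i : R ⊕ Fs) (j : T),
        S.msg (c v) t i j = S.msg (c w) t i j := by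
      -- Induction on the round: nodes of `A` store zero for both `v` and `w`, and a node of `T`
      -- sends a function of earlier messages, on which `v` and `w` agree.
      intro m
      induction m using Nat.strong_induction_on with
      | _ m ih =>
        intro t ht i j
        by_cases hi : i ∈ O
        · exact congrFun (congrFun (congrFun hvw j) ⟨i, hi⟩) t
        · rcases i with i | i
          · have hiA : i ∈ A := by simpa [O] using hi
            rw [CooperativeScheme.msg, CooperativeScheme.msg, hcA v i hiA, hcA w i hiA]
          · have hiT : i ∈ T := by simpa [O] using hi
            rw [CooperativeScheme.msg, CooperativeScheme.msg]
            congr 1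
            funext t' ht' i'
            exact ih t' (by omega) t' rfl i' ⟨i, hiT⟩
    funext j
    rw [← hcT v j, ← hcT w j, ← hS _ (hcC v) j, ← hS _ (hcC w) j]
    congr 1
    funext t i
    exact hmsg t t rfl i j
  have hle := Fintype.card_le_of_injective Φ hΦ
  simp only [Fintype.card_pi, Fintype.card_fin, Finset.prod_const, Finset.card_univ,
    Fintype.card_coe, Finset.prod_pow_eq_pow_sum, ← pow_mul] at hle
  have hle' := (Nat.pow_le_pow_iff_right Fintype.one_lt_card).1 hle
  rw [mul_comm]
  refine hle'.trans_eq ?_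
  rw [← Finset.sum_coe_sort T]
  refine Finset.sum_congr rfl fun j _ => ?_
  rw [Finset.sum_coe_sort O (fun i => ∑ t, S.len t i j), Finset.sum_disjSum]

/-- Averaging a function over all permutations of the argument gives its mean. -/
theorem card_mul_sum_perm_apply {β : Type*} [Fintype β] [DecidableEq β] (f : β → ℚ) (j : β) :
    (Fintype.card β : ℚ) * ∑ σ : Equiv.Perm β, f (σ j) =
      Fintype.card (Equiv.Perm β) * ∑ i, f i := by
  have hconst : ∀ i, ∑ σ : Equiv.Perm β, f (σ i) = ∑ σ : Equiv.Perm β, f (σ j) := by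
    intro i
    rw [← Equiv.sum_comp (Equiv.mulRight (Equiv.swap i j))]
    simp
  calc (Fintype.card β : ℚ) * ∑ σ : Equiv.Perm β, f (σ j)
      = ∑ i : β, ∑ σ : Equiv.Perm β, f (σ i) := by simp [hconst]
    _ = ∑ σ : Equiv.Perm β, ∑ i, f i := by
        rw [Finset.sum_comm]
        exact Finset.sum_congr rfl fun σ _ => Equiv.sum_comp σ f
    _ = _ := by simp

/-- Averaging a function of two arguments over all permutations gives, off the diagonal, its mean
over the pairs of different arguments. -/
theorem card_mul_sum_perm_apply_apply {β : Type*} [Fintype β] [DecidableEq β] (g : β → β → ℚ)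
    {i j : β} (hij : i ≠ j) :
    (Fintype.card β * (Fintype.card β - 1) : ℚ) * ∑ σ : Equiv.Perm β, g (σ i) (σ j) =
      Fintype.card (Equiv.Perm β) * ∑ i, ∑ j, if i = j then 0 else g i j := by
  have hconst : ∀ i' j', i' ≠ j' → ∑ σ : Equiv.Perm β, g (σ i') (σ j') =
      ∑ σ : Equiv.Perm β, g (σ i) (σ j) := by
    intro i' j' hij'
    obtain ⟨τ, hi, hj⟩ : ∃ τ : Equiv.Perm β, τ i' = i ∧ τ j' = j := by
      -- The right factor, applied first, sends `i'` to `i`; the left one moves the image of `j'` to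
      -- `j` and fixes `i`.
      refine ⟨Equiv.swap (Equiv.swap i' i j') j * Equiv.swap i' i, ?_, by simp⟩
      have h1 : i ≠ Equiv.swap i' i j' := by
        intro h
        apply hij'
        apply (Equiv.swap i' i).injective
        rw [← h, Equiv.swap_apply_left]
      simp [Equiv.swap_apply_of_ne_of_ne h1 hij]
    subst hi hj
    exact (Equiv.sum_comp (Equiv.mulRight τ) (fun σ => g (σ i') (σ j'))).symm
  calc (Fintype.card β * (Fintype.card β - 1) : ℚ) * ∑ σ : Equiv.Perm β, g (σ i) (σ j)
      = ∑ p ∈ Finset.univ.offDiag, ∑ σ : Equiv.Perm β, g (σ p.1) (σ p.2) := by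
        rw [Finset.sum_congr rfl fun p hp => hconst p.1 p.2 (Finset.mem_offDiag.1 hp).2.2,
          Finset.sum_const, Finset.offDiag_card, nsmul_eq_mul,
          Nat.cast_sub (Nat.le_mul_self _)]
        push_cast [Finset.card_univ]
        ring
    _ = ∑ σ : Equiv.Perm β, ∑ i', ∑ j', if i' = j' then 0 else g i' j' := by
        rw [Finset.sum_comm]
        refine Finset.sum_congr rfl fun σ _ => ?_
        have h1 : ∀ f : β → β → ℚ, ∑ p ∈ Finset.univ.offDiag, f p.1 p.2 =
            ∑ i', ∑ j', if i' = j' then 0 else f i' j' := by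
          intro f
          have h2 : (Finset.univ : Finset β).offDiag =
              Finset.univ.filter (fun p : β × β => p.1 ≠ p.2) := by
            ext; simp
          rw [h2, Finset.sum_filter, Fintype.sum_prod_type]
          simp only [ne_eq, ite_not]
        rw [h1 (fun a b => g (σ a) (σ b)),
          ← Equiv.sum_comp σ (fun i' => ∑ j', if i' = j' then 0 else g i' j')]
        refine Finset.sum_congr rfl fun i' _ => ?_
        rw [← Equiv.sum_comp σ (fun j' => if σ i' = j' then 0 else g (σ i') j')]
        simp
    _ = _ := by simp

/-- The averaged form of the inequalities `|T| * l ≤ ...` for `|T| = u`. -/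
theorem le_weighted_sum_of_forall_card {α β : Type*} [Fintype α] [Fintype β] [DecidableEq α]
    [DecidableEq β] (f : α → β → ℚ) (g : β → β → ℚ) {k u : ℕ} {l : ℚ}
    (hyp : ∀ (T : Finset β) (A : Finset α), T.card + A.card = k →
      T.card * l ≤ ∑ j ∈ T, (∑ i ∈ Aᶜ, f i j + ∑ i ∈ Tᶜ, g i j))
    (hu : 1 ≤ u) (huk : u ≤ k) (huh : u ≤ Fintype.card β) (hka : k ≤ Fintype.card α)
    (hh : 2 ≤ Fintype.card β) :
    (Fintype.card β * Fintype.card α * (Fintype.card β - 1) : ℚ) * l ≤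
      (Fintype.card α - k + u) * (Fintype.card β - 1) * ∑ i, ∑ j, f i j +
      (Fintype.card β - u) * Fintype.card α * ∑ i, ∑ j, if i = j then 0 else g i j := by
  obtain ⟨T, -, hT⟩ := Finset.exists_subset_card_eq (s := (Finset.univ : Finset β)) (n := u)
    (by simpa using huh)
  obtain ⟨A, -, hA⟩ := Finset.exists_subset_card_eq (s := (Finset.univ : Finset α)) (n := k - u)
    (by simp; omega)
  set h : ℚ := ((Fintype.card β : ℕ) : ℚ)
  set d : ℚ := ((Fintype.card α : ℕ) : ℚ)
  have hh2 : (2 : ℚ) ≤ h := Nat.ofNat_le_cast.2 hh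
  have hd1 : (1 : ℚ) ≤ d := Nat.one_le_cast.2 ((hu.trans huk).trans hka)
  have hu1 : (1 : ℚ) ≤ u := by exact_mod_cast hu
  set Nα : ℚ := ((Fintype.card (Equiv.Perm α) : ℕ) : ℚ)
  set Nβ : ℚ := ((Fintype.card (Equiv.Perm β) : ℕ) : ℚ)
  have hNα : 0 < Nα := Nat.cast_pos.2 Fintype.card_pos
  have hNβ : 0 < Nβ := Nat.cast_pos.2 Fintype.card_pos
  have hAc : ((Aᶜ).card : ℚ) = d - k + u := by
    rw [Finset.card_compl, hA, Nat.cast_sub (by omega), Nat.cast_sub huk]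
    ring
  have hTc : ((Tᶜ).card : ℚ) = h - u := by
    rw [Finset.card_compl, hT, Nat.cast_sub huh]
  have hperm : ∀ (ρ : Equiv.Perm α) (σ : Equiv.Perm β),
      u * l ≤ ∑ j ∈ T, (∑ i ∈ Aᶜ, f (ρ i) (σ j) + ∑ i ∈ Tᶜ, g (σ i) (σ j)) := by
    intro ρ σ
    have h1 := hyp (T.map σ.toEmbedding) (A.map ρ.toEmbedding) (by simp; omega)
    have h2 : (A.map ρ.toEmbedding)ᶜ = Aᶜ.map ρ.toEmbedding := by
      ext x; simp [Finset.mem_map_equiv]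
    have h3 : (T.map σ.toEmbedding)ᶜ = Tᶜ.map σ.toEmbedding := by
      ext x; simp [Finset.mem_map_equiv]
    rw [h2, h3] at h1
    simpa [hT] using h1
  have hsum : ∑ ρ : Equiv.Perm α, ∑ σ : Equiv.Perm β, u * l ≤
      ∑ ρ : Equiv.Perm α, ∑ σ : Equiv.Perm β,
        ∑ j ∈ T, (∑ i ∈ Aᶜ, f (ρ i) (σ j) + ∑ i ∈ Tᶜ, g (σ i) (σ j)) :=
    Finset.sum_le_sum fun ρ _ => Finset.sum_le_sum fun σ _ => hperm ρ σ
  have hswap : ∑ ρ : Equiv.Perm α, ∑ σ : Equiv.Perm β,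
        ∑ j ∈ T, (∑ i ∈ Aᶜ, f (ρ i) (σ j) + ∑ i ∈ Tᶜ, g (σ i) (σ j)) =
      ∑ j ∈ T, (∑ i ∈ Aᶜ, ∑ ρ : Equiv.Perm α, ∑ σ : Equiv.Perm β, f (ρ i) (σ j) +
        ∑ i ∈ Tᶜ, Nα * ∑ σ : Equiv.Perm β, g (σ i) (σ j)) := by
    have h1 : ∀ ρ : Equiv.Perm α, ∑ σ : Equiv.Perm β,
        ∑ j ∈ T, (∑ i ∈ Aᶜ, f (ρ i) (σ j) + ∑ i ∈ Tᶜ, g (σ i) (σ j)) =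
        ∑ j ∈ T, (∑ i ∈ Aᶜ, ∑ σ : Equiv.Perm β, f (ρ i) (σ j) +
          ∑ i ∈ Tᶜ, ∑ σ : Equiv.Perm β, g (σ i) (σ j)) := by
      intro ρ
      rw [Finset.sum_comm]
      refine Finset.sum_congr rfl fun j _ => ?_
      rw [Finset.sum_add_distrib, Finset.sum_comm]
      congr 1
      rw [Finset.sum_comm]
    rw [Finset.sum_congr rfl fun ρ _ => h1 ρ, Finset.sum_comm]
    refine Finset.sum_congr rfl fun j _ => ?_
    rw [Finset.sum_add_distrib, Finset.sum_comm]
    congr 1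
    simp [Finset.mul_sum, Nα]
  have hf : ∀ i j, ∑ ρ : Equiv.Perm α, ∑ σ : Equiv.Perm β, f (ρ i) (σ j) =
      Nα * Nβ * (∑ i, ∑ j, f i j) / (d * h) := by
    intro i j
    rw [eq_div_iff (by positivity)]
    have h1 := card_mul_sum_perm_apply (fun x => ∑ σ : Equiv.Perm β, f x (σ j)) i
    have h2 : h * ∑ x, ∑ σ : Equiv.Perm β, f x (σ j) = Nβ * ∑ x, ∑ y, f x y := by
      rw [Finset.mul_sum, Finset.mul_sum]
      exact Finset.sum_congr rfl fun x _ => card_mul_sum_perm_apply (f x) j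
    linear_combination h * h1 + Nα * h2
  have hg : ∀ j ∈ T, ∀ i ∈ Tᶜ, Nα * ∑ σ : Equiv.Perm β, g (σ i) (σ j) =
      Nα * Nβ * (∑ i, ∑ j, if i = j then 0 else g i j) / (h * (h - 1)) := by
    intro j hj i hi
    rw [eq_div_iff (by apply ne_of_gt; apply mul_pos <;> linarith)]
    have hij : i ≠ j := by
      rintro rfl
      exact Finset.mem_compl.1 hi hj
    linear_combination Nα * card_mul_sum_perm_apply_apply g hij
  rw [hswap, Finset.sum_congr rfl fun j hj => congrArg₂ (· + ·)
    (Finset.sum_congr rfl fun i _ => hf i j) (Finset.sum_congr rfl fun i hi => hg j hj i hi)] at hsum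
  simp only [Finset.sum_const, nsmul_eq_mul, hAc, hTc, hT, Finset.card_univ] at hsum
  set B := ∑ i, ∑ j, f i j
  set G := ∑ i, ∑ j, if i = j then 0 else g i j
  have hh0 : h ≠ 0 := by positivity
  have hd0 : d ≠ 0 := by positivity
  have hh10 : h - 1 ≠ 0 := by linarith
  -- Both sides of `hsum` carry the factor `u * Nα * Nβ`; multiplying by `h * d * (h - 1)` clears
  -- the denominators.
  have key : (u * Nα * Nβ) * (h * d * (h - 1) * l) ≤
      (u * Nα * Nβ) * ((d - k + u) * (h - 1) * B + (h - u) * d * G) := by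
    have h0 : 0 ≤ h * d * (h - 1) := by
      apply mul_nonneg <;> [positivity; linarith]
    calc (u * Nα * Nβ) * (h * d * (h - 1) * l) = h * d * (h - 1) * (Nα * (Nβ * (u * l))) := by ring
      _ ≤ _ := mul_le_mul_of_nonneg_left hsum h0
      _ = _ := by field_simp
  exact le_of_mul_le_mul_left key (by positivity)

/-- The optimization step of the cut-set bound for cooperative repair. -/
theorem cut_set_le_of_forall_card {α β : Type*} [Fintype α] [Fintype β] [DecidableEq α]
    [DecidableEq β] (f : α → β → ℚ) (g : β → β → ℚ) {k : ℕ} {l : ℚ}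
    (hyp : ∀ (T : Finset β) (A : Finset α), T.card + A.card = k →
      T.card * l ≤ ∑ j ∈ T, (∑ i ∈ Aᶜ, f i j + ∑ i ∈ Tᶜ, g i j))
    (hk : 1 ≤ k) (hka : k ≤ Fintype.card α) (hh : 2 ≤ Fintype.card β) :
    (Fintype.card β * (Fintype.card α + Fintype.card β - 1) : ℚ) * l ≤
      (Fintype.card α + Fintype.card β - k) *
        (∑ i, ∑ j, f i j + ∑ i, ∑ j, if i = j then 0 else g i j) := by
  have h1 := le_weighted_sum_of_forall_card f g hyp le_rfl hk (by omega) hka hh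
  set h : ℚ := ((Fintype.card β : ℕ) : ℚ)
  set d : ℚ := ((Fintype.card α : ℕ) : ℚ)
  set B := ∑ i, ∑ j, f i j
  set G := ∑ i, ∑ j, if i = j then 0 else g i j
  have hh2 : (2 : ℚ) ≤ h := Nat.ofNat_le_cast.2 hh
  have hk1 : (1 : ℚ) ≤ k := by exact_mod_cast hk
  have hkd : (k : ℚ) ≤ d := Nat.cast_le.2 hka
  have hpos : 0 < d * (h - 1) := by apply mul_pos <;> linarith
  rw [Nat.cast_one] at h1
  -- The second constraint is `u = min k h`. In each case the multipliers give `B` and `G` the same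
  -- coefficient `d * (h - 1) * (d + h - k)`.
  rcases le_total k (Fintype.card β) with hkh | hkh
  · have h2 := le_weighted_sum_of_forall_card f g hyp hk le_rfl hkh hka hh
    refine le_of_mul_le_mul_left ?_ hpos
    have h3 := mul_le_mul_of_nonneg_left h2 (show 0 ≤ h - 1 by linarith)
    have h4 := mul_le_mul_of_nonneg_left h1 (show 0 ≤ d by linarith)
    linear_combination h3 + h4
  · have h2 := le_weighted_sum_of_forall_card f g hyp (by omega) hkh le_rfl hka hh
    refine le_of_mul_le_mul_left ?_ hpos
    have h3 := mul_le_mul_of_nonneg_left h2 (show 0 ≤ (k : ℚ) - 1 by linarith)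
    have h4 := mul_le_mul_of_nonneg_left h1 (show 0 ≤ d + h - k by linarith)
    linear_combination h3 + h4

/-- The cut-set bound for cooperative repair of an MDS array code. -/
theorem CooperativeScheme.cut_set_le_bandwidth {F ι : Type*} [Field F] [Fintype F]
    [Fintype ι] {n k h d : ℕ} {C : Submodule F (Fin n → ι → F)} (hC : IsMDSArrayCode k C)
    (hk : 1 ≤ k) (hkd : k ≤ d) (hh : 2 ≤ h)
    {Fs R : Finset (Fin n)} (hFR : Disjoint Fs R) (hFs : Fs.card = h) (hR : R.card = d)
    (S : CooperativeScheme F ι Fs R) (hS : S.Repairs C) :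
    h * (d + h - 1) * Fintype.card ι ≤ (d + h - k) * S.bandwidth := by
  have hyp := cut_set_le_of_forall_card (α := R) (β := Fs) (k := k) (l := Fintype.card ι)
    (fun i j => ((∑ t, S.len t (Sum.inl i) j : ℕ) : ℚ))
    (fun i j => ((∑ t, S.len t (Sum.inr i) j : ℕ) : ℚ))
    (fun T A hTA => by exact_mod_cast S.card_mul_card_le_sum_len hC hFR hS T A hTA)
    hk (by simpa [hR] using hkd) (by simpa [hFs] using hh)
  have hb : (S.bandwidth : ℚ) = ∑ i : R, ∑ j, ((∑ t, S.len t (Sum.inl i) j : ℕ) : ℚ) +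
      ∑ i : Fs, ∑ j, if i = j then 0 else ((∑ t, S.len t (Sum.inr i) j : ℕ) : ℚ) := by
    have h1 : S.bandwidth = ∑ i : R, ∑ j, (∑ t, S.len t (Sum.inl i) j) +
        ∑ i : Fs, ∑ j, if i = j then 0 else (∑ t, S.len t (Sum.inr i) j) := by
      unfold CooperativeScheme.bandwidth
      rw [Finset.sum_comm, Fintype.sum_sum_type]
      congr 1
      · refine Finset.sum_congr rfl fun i _ => ?_
        rw [Finset.sum_comm]
        simp
      · refine Finset.sum_congr rfl fun i _ => ?_
        rw [Finset.sum_comm]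
        refine Finset.sum_congr rfl fun j _ => ?_
        by_cases hij : i = j <;> simp [hij]
    rw [h1]
    push_cast
    rfl
  rw [← hb, Fintype.card_coe, Fintype.card_coe, hFs, hR] at hyp
  have e1 : ((d + h - 1 : ℕ) : ℚ) = d + h - 1 := by
    rw [Nat.cast_sub (by omega)]; push_cast; ring
  have e2 : ((d + h - k : ℕ) : ℚ) = d + h - k := by
    rw [Nat.cast_sub (by omega)]; push_cast; ring
  rw [← e1, ← e2] at hyp
  exact_mod_cast hyp

/-! ### Repair by line sums -/

/-- The combination of the symbols `(bs (u - a i), a')` of a node, where `a'` is `a` with its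
`i`-th digit replaced by `u`. -/
def lineSum {F : Type*} [AddCommMonoid F] {n m s : ℕ} [NeZero s] (bs : Fin s → Fin m) (i : Fin n)
    (x : Fin m × (Fin n → Fin s) → F) (a : Fin n → Fin s) : F :=
  ∑ u, x (bs (u - a i), Function.update a i u)

theorem lineSum_sub {F : Type*} [AddCommGroup F] {n m s : ℕ} [NeZero s] (bs : Fin s → Fin m)
    (i : Fin n) (x y : Fin m × (Fin n → Fin s) → F) (a : Fin n → Fin s) :
    lineSum bs i (x - y) a = lineSum bs i x a - lineSum bs i y a := by
  simp [lineSum, Finset.sum_sub_distrib]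

/-- If the line sums in direction `i` of enough nodes vanish, then those of all nodes other than
`i` vanish, and so do the symbols of node `i` on this line. -/
theorem eq_zero_of_lineSum_eq_zero {F : Type*} [Field F] {n k m s : ℕ} [NeZero s]
    {lam : Fin n → Fin s → F} (hlam : Function.Injective (Function.uncurry lam))
    {c : Fin n → Fin m × (Fin n → Fin s) → F} (hc : c ∈ replicatedCode n k m s lam)
    (bs : Fin s → Fin m) {i : Fin n} {R : Finset (Fin n)} (hi : i ∉ R)
    (hR : R.card + 1 = s + k) (a : Fin n → Fin s)
    (h : ∀ j ∈ R, lineSum bs i (c j) a = 0) :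
    (∀ u, c i (bs (u - a i), Function.update a i u) = 0) ∧
      ∀ j, j ≠ i → lineSum bs i (c j) a = 0 := by
  classical
  let U := insert i R
  have hU : U.card = s + k := by rw [Finset.card_insert_of_notMem hi, hR]
  have hUn : U.card ≤ n := by simpa using U.card_le_univ
  -- Along the line only the point of node `i` varies, so its `s` symbols stay separate; the symbols
  -- of any other node share one point and merge into a line sum.
  let x : Fin s ⊕ {j // j ∉ U} → F := Sum.elim (lam i) (fun j => lam j (a j))
  let y : Fin s ⊕ {j // j ∉ U} → F :=
    Sum.elim (fun u => c i (bs (u - a i), Function.update a i u))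
      (fun j => lineSum bs i (c j) a)
  have hx : Function.Injective x := by
    rintro (u | j) (v | j') hij
    · exact congrArg Sum.inl (Prod.ext_iff.1 (@hlam (i, u) (i, v) hij)).2
    · have : i = j'.1 := (Prod.ext_iff.1 (@hlam (i, u) (j'.1, a j') hij)).1
      exact absurd (Finset.mem_insert.2 (Or.inl this.symm)) j'.2
    · have : j.1 = i := (Prod.ext_iff.1 (@hlam (j.1, a j) (i, v) hij)).1
      exact absurd (Finset.mem_insert.2 (Or.inl this)) j.2
    · exact congrArg Sum.inr (Subtype.ext (Prod.ext_iff.1 (@hlam (j.1, a j) (j'.1, a j') hij)).1)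
  -- The count is `s + (n - (s + k))`.
  have hcard : Fintype.card (Fin s ⊕ {j // j ∉ U}) ≤ n - k := by
    rw [Fintype.card_sum, Fintype.card_subtype_compl, Fintype.card_fin, Fintype.card_fin,
      Fintype.card_coe]
    omega
  have hy : y = 0 := by
    refine eq_zero_of_forall_sum_pow_mul_eq_zero hx (n - k) hcard fun t ht => ?_
    have h0 : ∑ u, ∑ j, lam j (Function.update a i u j) ^ t *
        c j (bs (u - a i), Function.update a i u) = 0 :=
      Finset.sum_eq_zero fun u _ => hc t ht _ _
    have hne : ∀ j, j ≠ i → ∑ u, lam j (Function.update a i u j) ^ t *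
        c j (bs (u - a i), Function.update a i u) = lam j (a j) ^ t * lineSum bs i (c j) a := by
      intro j hj
      simp only [Function.update_of_ne hj, lineSum, Finset.mul_sum]
    rw [Finset.sum_comm, ← Finset.sum_add_sum_compl U, Finset.sum_insert hi,
      Finset.sum_eq_zero (s := R), add_zero] at h0
    · rw [Fintype.sum_sum_type, ← h0]
      congr 1
      · simp [x, y]
      · refine (Finset.sum_subtype Uᶜ (p := fun j => j ∉ U) (by simp)
          (fun j => lam j (a j) ^ t * lineSum bs i (c j) a)).symm.trans ?_
        refine Finset.sum_congr rfl fun j hj => (hne j ?_).symm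
        rintro rfl
        exact Finset.mem_compl.1 hj (Finset.mem_insert_self _ _)
    · intro j hj
      rw [hne j (fun e => hi (e ▸ hj)), h j hj, mul_zero]
  refine ⟨fun u => congrFun hy (Sum.inl u), fun j hj => ?_⟩
  by_cases hjR : j ∈ R
  · exact h j hjR
  · exact congrFun hy (Sum.inr ⟨j, by simp [U, hj, hjR]⟩)

/-- The replicas used for the repair of the `p`-th failed node: one of its own, and `s - 1` which
are common to all failed nodes. -/
def replicaIndex {h m s : ℕ} (hm : s - 1 + h ≤ m) (p : Fin h) (u : Fin s) : Fin m :=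
  if hu : (u : ℕ) = 0 then ⟨s - 1 + p, by omega⟩ else ⟨u - 1, by omega⟩

theorem replicaIndex_of_ne_zero {h m s : ℕ} [NeZero s] (hm : s - 1 + h ≤ m) (p q : Fin h)
    {u : Fin s} (hu : u ≠ 0) : replicaIndex hm p u = replicaIndex hm q u := by
  have : (u : ℕ) ≠ 0 := fun e => hu (Fin.ext e)
  simp [replicaIndex, this]

theorem exists_replicaIndex_eq {h m s : ℕ} [NeZero s] (hm : s - 1 + h = m) (q : Fin h)
    (b : Fin m) : (∃ u, replicaIndex hm.le q u = b) ∨ ∃ p, replicaIndex hm.le p (0 : Fin s) = b := by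
  by_cases hb : (b : ℕ) < s - 1
  · left
    refine ⟨⟨b + 1, by omega⟩, Fin.ext ?_⟩
    simp [replicaIndex]
  · right
    refine ⟨⟨b - (s - 1), by omega⟩, Fin.ext ?_⟩
    simp [replicaIndex]
    omega

/-- The line sums received by the failed node `j` from the helper nodes and from the other failed
nodes determine its content. -/
theorem eq_zero_of_forall_lineSum_eq_zero {F : Type*} [Field F] {n k h m s : ℕ} [NeZero s]
    {lam : Fin n → Fin s → F} (hlam : Function.Injective (Function.uncurry lam))
    {c : Fin n → Fin m × (Fin n → Fin s) → F} (hc : c ∈ replicatedCode n k m s lam)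
    (hm : s - 1 + h = m) {Fs R : Finset (Fin n)} (e : Fs ≃ Fin h) (hFR : Disjoint Fs R)
    (hR : R.card + 1 = s + k) (j : Fs)
    (hhelp : ∀ i ∈ R, ∀ a, lineSum (replicaIndex hm.le (e j)) j (c i) a = 0)
    (hfail : ∀ i : Fs, i ≠ j → ∀ a, lineSum (replicaIndex hm.le (e i)) i (c j) a = 0) :
    c j = 0 := by
  have hown : ∀ u a, c j (replicaIndex hm.le (e j) u, a) = 0 := by
    intro u a
    -- The base digit `a j - u` makes the point with digit `a j` use replica index `u`.
    have := (eq_zero_of_lineSum_eq_zero hlam hc (replicaIndex hm.le (e j))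
      (Finset.disjoint_left.1 hFR j.2) hR (Function.update a j (a j - u))
      fun i hi => hhelp i hi _).1 (a j)
    simpa using this
  funext ⟨b, a⟩
  rcases exists_replicaIndex_eq hm (e j) b with ⟨u, rfl⟩ | ⟨p, rfl⟩
  · exact hown u a
  · obtain ⟨i, rfl⟩ := e.surjective p
    by_cases hij : i = j
    · rw [hij]; exact hown 0 a
    · have h1 := hfail i hij a
      -- Only `u = a i` meets the replica private to `i`; the other terms lie in common replicas,
      -- where `hown` applies.
      rw [lineSum, Finset.sum_eq_single (a i)] at h1
      · simpa using h1
      · intro u _ hu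
        rw [replicaIndex_of_ne_zero hm.le (e i) (e j) (sub_ne_zero.2 hu)]
        exact hown _ _
      · simp

/-! ### The two-round scheme -/

/-- A surjection from the natural numbers below `s ^ n` onto the `n`-digit strings in base `s`. -/
noncomputable def digitsOfNat (n s : ℕ) [NeZero s] (q : ℕ) : Fin n → Fin s :=
  -- The default is never used by the scheme: every message has length `0` or `s ^ n`.
  if hq : q < s ^ n then finFunctionFinEquiv.symm ⟨q, hq⟩ else 0

theorem exists_digitsOfNat_eq {n s : ℕ} [NeZero s] (a : Fin n → Fin s) :
    ∃ q : Fin (s ^ n), digitsOfNat n s q = a :=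
  ⟨finFunctionFinEquiv a, (dif_pos (finFunctionFinEquiv a).2).trans (Equiv.symm_apply_apply _ a)⟩

/-- The number of symbols sent in the two-round scheme: each helper node sends `N` symbols to each
failed node in the first round, each failed node sends `N` symbols to each other failed node in the
second round. -/
def twoRoundLen {n : ℕ} (Fs R : Finset (Fin n)) (N : ℕ) (t : Fin 2) : R ⊕ Fs → Fs → ℕ
  | Sum.inl _, _ => if t = 0 then N else 0
  | Sum.inr i, j => if t = 1 ∧ i ≠ j then N else 0

theorem CooperativeScheme.msg_inl {F ι : Type*} {n : ℕ} {Fs R : Finset (Fin n)}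
    (S : CooperativeScheme F ι Fs R) (c : Fin n → ι → F) (t : Fin S.rounds) (i : R) (j : Fs) :
    S.msg c t (Sum.inl i) j = S.helperMsg t i j (c i) := by
  rw [CooperativeScheme.msg]

theorem CooperativeScheme.msg_inr {F ι : Type*} {n : ℕ} {Fs R : Finset (Fin n)}
    (S : CooperativeScheme F ι Fs R) (c : Fin n → ι → F) (t : Fin S.rounds) (i j : Fs) :
    S.msg c t (Sum.inr i) j = S.failedMsg t i j (fun t' _ i' => S.msg c t' i' i) := by
  rw [CooperativeScheme.msg]

section TwoRoundScheme

variable {F : Type*} [Field F] {n m s h : ℕ} [NeZero s] {Fs R : Finset (Fin n)}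

open Classical in
/-- The two-round repair scheme. Helper node `i` sends to the failed node `j` its line sums in
direction `j`; from these the failed node `j` computes the line sums in direction `j` of each
other failed node and sends them to it. -/
noncomputable def twoRoundScheme (C : Submodule F (Fin n → Fin m × (Fin n → Fin s) → F))
    (hm : s - 1 + h ≤ m) (e : Fs ≃ Fin h) :
    CooperativeScheme F (Fin m × (Fin n → Fin s)) Fs R where
  rounds := 2
  len := twoRoundLen Fs R (s ^ n)
  helperMsg _ _ j x q := lineSum (replicaIndex hm (e j)) j x (digitsOfNat n s q)
  failedMsg t i j r q :=
    -- Any codeword consistent with the received line sums will do: by linearity, two of them differ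
    -- by a codeword to which `eq_zero_of_lineSum_eq_zero` applies.
    if hr : ∃ c ∈ C, ∀ (t' : Fin 2) (ht : t' < t) (i' : R) q', r t' ht (Sum.inl i') q' =
        lineSum (replicaIndex hm (e i)) i (c i') (digitsOfNat n s q') then
      lineSum (replicaIndex hm (e i)) i (hr.choose j) (digitsOfNat n s q)
    else 0
  decode j r :=
    if hr : ∃ c ∈ C,
        (∀ (t : Fin 2) (i : R) q, r t (Sum.inl i) q =
          lineSum (replicaIndex hm (e j)) j (c i) (digitsOfNat n s q)) ∧
        ∀ (t : Fin 2) (i : Fs) q, r t (Sum.inr i) q =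
          lineSum (replicaIndex hm (e i)) i (c j) (digitsOfNat n s q) then
      hr.choose j
    else 0

theorem twoRoundScheme_bandwidth (C : Submodule F (Fin n → Fin m × (Fin n → Fin s) → F))
    (hm : s - 1 + h ≤ m) (e : Fs ≃ Fin h) :
    (twoRoundScheme (R := R) C hm e).bandwidth =
      Fs.card * (R.card + (Fs.card - 1)) * s ^ n := by
  have h1 : (twoRoundScheme (R := R) C hm e).bandwidth = ∑ t : Fin 2, ∑ i : R ⊕ Fs, ∑ j : Fs,
      if i = Sum.inr j then 0 else twoRoundLen Fs R (s ^ n) t i j := rfl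
  have h2 : ∀ i : Fs, ∑ j : Fs, (if i = j then 0 else s ^ n) = (Fs.card - 1) * s ^ n := by
    intro i
    rw [Finset.sum_ite, Finset.sum_const_zero, zero_add, Finset.sum_const, Finset.filter_ne,
      Finset.card_erase_of_mem (Finset.mem_univ i), Finset.card_univ, Fintype.card_coe, smul_eq_mul]
  have h3 : ∀ i j : Fs, (if i = j then 0 else if i = j then 0 else s ^ n) =
      if i = j then 0 else s ^ n := by
    intro i j
    split_ifs <;> rfl
  rw [h1]
  simp only [Fin.sum_univ_two, twoRoundLen, Fintype.sum_sum_type, reduceCtorEq, Sum.inr.injEq,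
    if_true, if_false, ne_eq, true_and, false_and, ite_not, zero_ne_one, one_ne_zero, ite_self, h2,
    h3, Finset.sum_const, Finset.card_univ, Fintype.card_coe, smul_eq_mul]
  ring

/-- The codeword chosen by the decoder minus the stored one lies in the code, and all line sums
received by `j` vanish on it, hence so does its node `j`. -/
theorem twoRoundScheme_repairs {k : ℕ} {lam : Fin n → Fin s → F}
    (hlam : Function.Injective (Function.uncurry lam)) (hm : s - 1 + h = m) (e : Fs ≃ Fin h)
    (hFR : Disjoint Fs R) (hR : R.card + 1 = s + k) :
    (twoRoundScheme (R := R) (replicatedCode n k m s lam) hm.le e).Repairs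
      (replicatedCode n k m s lam) := by
  intro c hc j
  let S := twoRoundScheme (R := R) (replicatedCode n k m s lam) hm.le e
  have hhelp : ∀ (t : Fin 2) (i : R) (j : Fs) q, S.msg c t (Sum.inl i) j q =
      lineSum (replicaIndex hm.le (e j)) j (c i) (digitsOfNat n s q) := by
    intro t i j q
    exact congrFun (S.msg_inl c t i j) q
  have hlen : ∀ i j, i ≠ j → S.len (1 : Fin 2) (Sum.inr i) j = s ^ n :=
    fun i j hij => if_pos ⟨rfl, hij⟩
  have hfail : ∀ (t : Fin 2) (i j : Fs) q, S.msg c t (Sum.inr i) j q =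
      lineSum (replicaIndex hm.le (e i)) i (c j) (digitsOfNat n s q) := by
    intro t i j q
    -- Otherwise the message is empty and has no index `q`.
    have ht : t = 1 ∧ i ≠ j := by
      by_contra hcon
      have h0 : S.len t (Sum.inr i) j = 0 := if_neg hcon
      exact absurd q.2 (by omega)
    obtain ⟨rfl, hij⟩ := ht
    have hr : ∃ c' ∈ replicatedCode n k m s lam,
        ∀ (t' : Fin 2) (ht : t' < 1) (i' : R) q', S.msg c t' (Sum.inl i') i q' =
        lineSum (replicaIndex hm.le (e i)) i (c' i') (digitsOfNat n s q') :=
      ⟨c, hc, fun t' _ i' q' => hhelp t' i' i q'⟩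
    have hval : S.msg c (1 : Fin 2) (Sum.inr i) j q =
        lineSum (replicaIndex hm.le (e i)) i (hr.choose j) (digitsOfNat n s q) :=
      (congrFun (S.msg_inr c (1 : Fin 2) i j) q).trans (dif_pos hr)
    rw [hval, ← sub_eq_zero, ← lineSum_sub]
    have hmem := (replicatedCode n k m s lam).sub_mem hr.choose_spec.1 hc
    refine (eq_zero_of_lineSum_eq_zero hlam hmem _ (Finset.disjoint_left.1 hFR i.2) hR _
      fun i' hi' => ?_).2 j fun hji => hij (Subtype.ext hji.symm)
    have h1 := hr.choose_spec.2 0 (by decide) ⟨i', hi'⟩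
    rw [Pi.sub_apply, lineSum_sub, sub_eq_zero]
    obtain ⟨q', hq'⟩ := exists_digitsOfNat_eq (digitsOfNat n s q)
    rw [← hq']
    exact (h1 q').symm.trans (hhelp 0 ⟨i', hi'⟩ i q')
  have hr : ∃ c' ∈ replicatedCode n k m s lam,
      (∀ (t : Fin 2) (i : R) q, S.msg c t (Sum.inl i) j q =
        lineSum (replicaIndex hm.le (e j)) j (c' i) (digitsOfNat n s q)) ∧
      ∀ (t : Fin 2) (i : Fs) q, S.msg c t (Sum.inr i) j q =
        lineSum (replicaIndex hm.le (e i)) i (c' j) (digitsOfNat n s q) :=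
    ⟨c, hc, fun t i q => hhelp t i j q, fun t i q => hfail t i j q⟩
  have hval : S.decode j (fun t i => S.msg c t i j) = hr.choose j := dif_pos hr
  rw [hval, ← sub_eq_zero]
  have hmem := (replicatedCode n k m s lam).sub_mem hr.choose_spec.1 hc
  refine eq_zero_of_forall_lineSum_eq_zero hlam hmem hm e hFR hR j ?_ ?_
  · intro i hi a
    obtain ⟨q, rfl⟩ := exists_digitsOfNat_eq a
    rw [Pi.sub_apply, lineSum_sub, sub_eq_zero]
    exact (hr.choose_spec.2.1 0 ⟨i, hi⟩ q).symm.trans (hhelp 0 ⟨i, hi⟩ j q)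
  · intro i hij a
    obtain ⟨q, rfl⟩ := exists_digitsOfNat_eq a
    rw [Pi.sub_apply, lineSum_sub, sub_eq_zero]
    exact (hr.choose_spec.2.2 1 i (q.cast (hlen i j hij).symm)).symm.trans
      (hfail 1 i j (q.cast (hlen i j hij).symm))

end TwoRoundScheme

/-! ### The main theorem -/

theorem mainTheorem1 {F : Type*} [Field F] [Fintype F] (n k h d : ℕ)
    (hk : 1 ≤ k) (hkd : k ≤ d) (hh : 2 ≤ h) (hhd : d + h ≤ n)
    (hF : (d + 1 - k) * n ≤ Fintype.card F) :
    (∃ lam : Fin n → Fin (d + 1 - k) → F, Function.Injective (Function.uncurry lam)) ∧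
    ∀ lam : Fin n → Fin (d + 1 - k) → F, Function.Injective (Function.uncurry lam) →
      IsCooperativeMSR k h d (replicatedCode n k (d + h - k) (d + 1 - k) lam) ∧
      ∀ Fs R : Finset (Fin n), Disjoint Fs R → Fs.card = h → R.card = d →
        cooperativeBandwidth (replicatedCode n k (d + h - k) (d + 1 - k) lam) Fs R =
            ((h * (d + h - 1) * (d + 1 - k) ^ n : ℕ) : ℕ∞) ∧
        ∃ S : CooperativeScheme F (Fin (d + h - k) × (Fin n → Fin (d + 1 - k))) Fs R,
          S.rounds = 2 ∧ S.Repairs (replicatedCode n k (d + h - k) (d + 1 - k) lam) ∧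
          S.bandwidth = h * (d + h - 1) * (d + 1 - k) ^ n := by
  constructor
  · obtain ⟨f⟩ := Function.Embedding.nonempty_of_card_le
      (α := Fin n × Fin (d + 1 - k)) (β := F) (by simpa [mul_comm] using hF)
    exact ⟨Function.curry f, by simpa using f.injective⟩
  intro lam hlam
  have : NeZero (d + 1 - k) := ⟨by omega⟩
  have hMDS := isMDSArrayCode_replicatedCode (k := k) (m := d + h - k) hlam
  have hcard : Fintype.card (Fin (d + h - k) × (Fin n → Fin (d + 1 - k))) =
      (d + h - k) * (d + 1 - k) ^ n := by simp
  have hmain : ∀ Fs R : Finset (Fin n), Disjoint Fs R → Fs.card = h → R.card = d →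
      cooperativeBandwidth (replicatedCode n k (d + h - k) (d + 1 - k) lam) Fs R =
          ((h * (d + h - 1) * (d + 1 - k) ^ n : ℕ) : ℕ∞) ∧
      ∃ S : CooperativeScheme F (Fin (d + h - k) × (Fin n → Fin (d + 1 - k))) Fs R,
        S.rounds = 2 ∧ S.Repairs (replicatedCode n k (d + h - k) (d + 1 - k) lam) ∧
        S.bandwidth = h * (d + h - 1) * (d + 1 - k) ^ n := by
    intro Fs R hFR hFs hR
    have hm : (d + 1 - k) - 1 + h = d + h - k := by omega
    let e : Fs ≃ Fin h := Fs.equivFinOfCardEq hFs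
    let S := twoRoundScheme (R := R) (replicatedCode n k (d + h - k) (d + 1 - k) lam) hm.le e
    have hS : S.Repairs (replicatedCode n k (d + h - k) (d + 1 - k) lam) :=
      twoRoundScheme_repairs hlam hm e hFR (by omega)
    have hSb : S.bandwidth = h * (d + h - 1) * (d + 1 - k) ^ n := by
      rw [twoRoundScheme_bandwidth, hFs, hR, ← Nat.add_sub_assoc (by omega : 1 ≤ h)]
    refine ⟨le_antisymm ?_ ?_, S, rfl, hS, hSb⟩
    · rw [← hSb]
      exact iInf₂_le S hS
    · refine le_iInf₂ fun S' hS' => Nat.cast_le.2 ?_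
      have h1 := S'.cut_set_le_bandwidth hMDS hk hkd hh hFR hFs hR hS'
      -- The number of replicas equals the factor `d + h - k` of the cut-set bound, and cancels.
      rw [hcard, mul_left_comm] at h1
      exact Nat.le_of_mul_le_mul_left h1 (by omega)
  refine ⟨⟨hMDS, fun Fs R hFR hFs hR => ⟨_, (hmain Fs R hFR hFs hR).1, ?_⟩⟩, hmain⟩
  have e1 : ((d + h - 1 : ℕ) : ℚ) = d + h - 1 := by
    rw [Nat.cast_sub (by omega)]; push_cast; ring
  have e2 : ((d + h - k : ℕ) : ℚ) = h + d - k := by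
    rw [Nat.cast_sub (by omega)]; push_cast; ring
  have hne : (h + d - k : ℚ) ≠ 0 := by
    rw [← e2]; exact_mod_cast (show d + h - k ≠ 0 by omega)
  rw [hcard, eq_div_iff hne, Nat.cast_mul (d + h - k), Nat.cast_mul (h * (d + h - 1)),
    Nat.cast_mul h, e1, e2]
  ring
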